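/- **Setting.** A congestion game $G$ has players $1,\dots,N$, finitely many resources $E$, for every player $u$ a finite non-empty explicitly listed family $S_u\subseteq 2^E$ of strategies, and for every $e\in E$ a non-negative non-decreasing rational cost function $f_e$. In a state $s$, $n_e(s)$ is the number of players using $e$, $c_u(s)=\sum_{e\in s_u}f_e(n_e(s))$ and $c(s)=\sum_u c_u(s)$ is the social cost. For $\alpha\ge 0$ and $F:S\to\mathbb Q_{\ge 0}$, a state $s$ is an $\alpha$-approximate local optimum of $F$ if no player $u$ has a strategy $s'_u$ with $\alpha F(s'_u,s_{-u})<F(s)$. For each resource let $h_e(n)=n f_e(n)$ and consider the linear program $\mathrm{LP}_{SC}$: minimise $\lambda_e$ over non-negative non-decreasing cost functions $f'_e$ (on $1,\dots,N+1$) subject to $$\lambda_e h_e(m)-m f'_e(n+1)+n f'_e(n)\ \ge\ h_e(n)\qquad\text{for all } n,m\in\{0,\dots,N\}.$$ For every $e$ let $(f'_e,\lambda_e)$ be any rational feasible solution of $\mathrm{LP}_{SC}$ (for instance an optimal one), let $\lambda=\max_e\lambda_e$ (with $\lambda=0$ if this maximum is negative or $E=\emptyset$), and $\zeta_{SC}(s)=\sum_{e}\sum_{i=1}^{n_e(s)}f'_e(i)$.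 The *local search with accuracy $\delta$ on $\zeta_{SC}$* starts in an arbitrary state and, as long as some unilateral move leads from the current state $s$ to a state $s'$ with $(1+\delta)\zeta_{SC}(s')<\zeta_{SC}(s)$, performs the first such move. Its running time counts bit operations; the input length $L$ is the length of the binary encoding of the game, of the values $f'_e(1),\dots,f'_e(N)$ and of $\varepsilon$. **Theorem.** There is a polynomial bound, the same for all games, such that for all such $G$, $(f'_e,\lambda_e)_e$, all rational $\varepsilon>0$ and all initial states: 1. The local search on $\zeta_{SC}$ with accuracy $\delta=\varepsilon/(N+1)$ halts in time polynomial in $L$ and $1/\varepsilon$. Its output is a $(1+\delta)$-approximate local optimum of $\zeta_{SC}$ and a $\lambda(1+\varepsilon)$-approximate local optimum of the social cost $c$. 2. The local search on $\zeta_{SC}$ with accuracy $\delta=\varepsilon/\bigl((1+\varepsilon)(N+1)^2(\lceil\lambda\rceil+1)\bigr)$ halts in time polynomial in $L$, $\lambda$ and $1/\varepsilon$. Its output $s$ satisfies $c(s)\le\lambda(1+\varepsilon)\,c(t)$ for all states $t$. -/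

import Mathlib

/-! Congestion games with explicitly listed strategies and rational cost functions. -/

/-- A finite congestion game: players `Fin N`, resources `Fin m`, the `k u` strategies of player `u`
are the sets of resources `strat u 0, …, strat u (k u - 1)`, and every resource `e` has a
non-negative, non-decreasing cost function `f e`. -/
structure CongestionGame where
  N : ℕ
  m : ℕ
  k : Fin N → ℕ
  k_pos : ∀ u, 0 < k u
  strat : (u : Fin N) → Fin (k u) → Finset (Fin m)
  f : Fin m → ℕ → ℚ
  f_nonneg : ∀ e n, 0 ≤ f e n
  f_mono : ∀ e, Monotone (f e)

namespace CongestionGame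

variable (G : CongestionGame)

/-- A state: every player picks (the index of) one of its strategies. -/
abbrev State : Type := (u : Fin G.N) → Fin (G.k u)

/-- `n_e(s)`, the number of players that use the resource `e` in the state `s`. -/
def load (s : G.State) (e : Fin G.m) : ℕ :=
  (Finset.univ.filter fun u => e ∈ G.strat u (s u)).card

/-- `c_u(s)`, the cost of player `u`. -/
def playerCost (s : G.State) (u : Fin G.N) : ℚ :=
  ∑ e ∈ G.strat u (s u), G.f e (G.load s e)

/-- `c(s)`, the social cost. -/
def socialCost (s : G.State) : ℚ := ∑ u, G.playerCost s u

/-- `(s'_u, s_{-u})`, where `s'_u` is the strategy of `u` with index `j`. -/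
def deviate (s : G.State) (u : Fin G.N) (j : Fin (G.k u)) : G.State := Function.update s u j

/-- The pseudo-potential `∑_e ∑_{i = 1}^{n_e(s)} f'_e(i)`. -/
def zeta (f' : Fin G.m → ℕ → ℚ) (s : G.State) : ℚ :=
  ∑ e, ∑ i ∈ Finset.Icc 1 (G.load s e), f' e i

/-- `s` is an `α`-approximate local optimum of `F`: there is no player `u` with a strategy `s'_u`
such that `α * F (s'_u, s_{-u}) < F s`. -/
def IsApproxLocalOpt (F : G.State → ℚ) (α : ℚ) (s : G.State) : Prop :=
  ∀ (u : Fin G.N) (j : Fin (G.k u)), F s ≤ α * F (G.deviate s u j)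

end CongestionGame

/-- `(f', lam)` is feasible for the linear program of the resource cost function `f` and at most
`N` players, where `h n = n * f n`:
`lam * h m - m * f' (n + 1) + n * f' n ≥ h n` for all `n, m ∈ [0, N]`, over the (non-negative and
non-decreasing) cost functions `f'`. The program asks for a feasible pair with the least `lam`. -/
structure LPscFeasible (N : ℕ) (f f' : ℕ → ℚ) (lam : ℚ) : Prop where
  smooth : ∀ n ≤ N, ∀ m ≤ N,
    (n : ℚ) * f n ≤ lam * ((m : ℚ) * f m) - (m : ℚ) * f' (n + 1) + (n : ℚ) * f' n
  nonneg : ∀ n ≤ N, 0 ≤ f' n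
  mono : ∀ n, 1 ≤ n → n ≤ N → f' n ≤ f' (n + 1)

/-! Encoding lengths and a cost model. -/

/-- Number of binary digits of numerator and denominator. -/
def ratSize (q : ℚ) : ℕ := Nat.size q.num.natAbs + Nat.size q.den

/-- A computed value together with the number of bit operations spent on it. -/
structure Timed (α : Type) where
  val : α
  time : ℕ

namespace Timed

instance : Monad Timed where
  pure a := ⟨a, 0⟩
  bind x g := ⟨(g x.val).val, x.time + (g x.val).time⟩

/-- Spend `c` bit operations. -/
def tick (c : ℕ) : Timed Unit := ⟨(), c⟩

/-- Charge for an arithmetic operation on rationals in lowest terms (quadratic in the lengths). -/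
def arithCost (a b : ℚ) : ℕ := (ratSize a + ratSize b) ^ 2

def add (a b : ℚ) : Timed ℚ := ⟨a + b, arithCost a b⟩

def mul (a b : ℚ) : Timed ℚ := ⟨a * b, arithCost a b⟩

def lt (a b : ℚ) : Timed Bool := ⟨decide (a < b), arithCost a b⟩

end Timed

namespace CongestionGame

variable (G : CongestionGame)

/-- Length of the encoding of the game (incidence vectors of all strategies, tables of the values
`f e 1, …, f e N`) together with the tables of the values `f' e 1, …, f' e N`. -/
def encLength (f' : Fin G.m → ℕ → ℚ) : ℕ :=
  G.N + G.m + (∑ u, G.k u * (G.m + 1)) +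
    ∑ e, ∑ i ∈ Finset.Icc 1 G.N, (ratSize (G.f e i) + ratSize (f' e i))

/-! The local search. Every access to the input or to the current state (which is no longer than
the input) is charged with a scan of the whole input, `G.encLength f'`. -/

/-- Compute `n_e(s)` by going through the players. -/
def loadT (f' : Fin G.m → ℕ → ℚ) (s : G.State) (e : Fin G.m) : Timed ℕ :=
  (List.finRange G.N).foldlM (fun n u => do
    Timed.tick (G.encLength f')
    pure (if e ∈ G.strat u (s u) then n + 1 else n)) 0

/-- Compute the pseudo-potential of a state. -/
def zetaT (f' : Fin G.m → ℕ → ℚ) (s : G.State) : Timed ℚ :=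
  (List.finRange G.m).foldlM (fun acc e => do
    Timed.tick (G.encLength f')
    let n ← G.loadT f' s e
    (List.range n).foldlM (fun a i => do
      Timed.tick (G.encLength f')
      Timed.add a (f' e (i + 1))) acc) 0

/-- All unilateral moves: a player and (the index of) one of its strategies. -/
def moves : List ((u : Fin G.N) × Fin (G.k u)) :=
  (List.finRange G.N).flatMap fun u => (List.finRange (G.k u)).map fun j => ⟨u, j⟩

/-- Given `z`, the value of the pseudo-potential at `s`, find the first move in the list to a state
`s'` with `(1 + δ) * zeta s' < z`, if there is one. -/
def firstMoveT (f' : Fin G.m → ℕ → ℚ) (δ z : ℚ) (s : G.State) :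
    List ((u : Fin G.N) × Fin (G.k u)) → Timed (Option G.State)
  | [] => pure none
  | ⟨u, j⟩ :: l => do
    Timed.tick (G.encLength f')
    let z' ← G.zetaT f' (G.deviate s u j)
    let a ← Timed.add 1 δ
    let y ← Timed.mul a z'
    let b ← Timed.lt y z
    if b then pure (some (G.deviate s u j)) else firstMoveT f' δ z s l

/-- One round of the local search with accuracy `δ`: the next state, or `none` if no unilateral
move improves the pseudo-potential by more than the factor `1 + δ`. -/
def stepT (f' : Fin G.m → ℕ → ℚ) (δ : ℚ) (s : G.State) : Timed (Option G.State) := do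
  let z ← G.zetaT f' s
  G.firstMoveT f' δ z s G.moves

/-- `G.LocalSearch f' δ s t T`: the local search with accuracy `δ` on the pseudo-potential, started
in `s`, halts with output `t` after `T` bit operations in total. -/
inductive LocalSearch (f' : Fin G.m → ℕ → ℚ) (δ : ℚ) : G.State → G.State → ℕ → Prop
  | halt (s : G.State) (h : (G.stepT f' δ s).val = none) :
      LocalSearch f' δ s s (G.stepT f' δ s).time
  | move (s s' t : G.State) (T : ℕ) (h : (G.stepT f' δ s).val = some s')
      (hr : LocalSearch f' δ s' t T) :
      LocalSearch f' δ s t ((G.stepT f' δ s).time + T)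

end CongestionGame

/-- `max_e lam_e` (and `0` if there is no resource). -/
def maxLam {m : ℕ} (lam : Fin m → ℚ) : ℚ := Finset.univ.fold max 0 lam

/-! The LP constraint with `n` the load before and `m` the load after a unilateral move, summed over
resources, gives c(s) ≤ λ c(s') + ζ(s) - ζ(s') (`socialCost_le_deviate`). The constraint with `m`
the load in an arbitrary state t gives the smoothness bound c(s) ≤ λ c(t) + ∑_u (ζ(s) - ζ(t_u,
s_{-u})) (`socialCost_le_sum_deviate`). At a (1+δ)-approximate local optimum each difference of
potentials is at most δζ. Since ζ ≤ N λ c (`zeta_le`), the chosen δ turns this error into a factor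
1+ε; in the second bound it is absorbed on the left.

For the running time, let L be `encLength`. All denominators divide one integer D ≤ 2^L, and ζ ≤
2^L. Hence partial sums have size O(L), and a positive ζ is at least 2^{-L}. Each move divides ζ by
more than 1+δ, so O(L/δ) rounds suffice (`exists_localSearch`), each of polynomial cost
(`stepT_time_le`). -/

/-! ### Bit lengths of rationals -/

theorem ratSize_mul_le (a b : ℚ) : ratSize (a * b) ≤ ratSize a + ratSize b := by
  have size_mul (m n : ℕ) : Nat.size (m * n) ≤ Nat.size m + Nat.size n := by
    rw [Nat.size_le, pow_add]
    exact Nat.mul_lt_mul'' (Nat.lt_size_self m) (Nat.lt_size_self n)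
  have h1 : Nat.size (a * b).num.natAbs ≤ Nat.size a.num.natAbs + Nat.size b.num.natAbs := by
    refine le_trans (Nat.size_le_size ?_) (size_mul _ _)
    rw [Rat.mul_num, ← Int.natAbs_mul]
    exact Int.natAbs_ediv_le_natAbs _ _
  have h2 : Nat.size (a * b).den ≤ Nat.size a.den + Nat.size b.den :=
    le_trans (Nat.size_le_size (Nat.le_of_dvd (by positivity) (Rat.mul_den_dvd a b)))
      (size_mul _ _)
  unfold ratSize
  omega

theorem ratSize_inv (a : ℚ) : ratSize a⁻¹ = ratSize a := by
  rcases eq_or_ne a 0 with rfl | h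
  · simp
  · have hs : a.num.sign.natAbs = 1 := by
      rw [Int.natAbs_sign_of_ne_zero (Rat.num_ne_zero.mpr h)]
    rw [ratSize, ratSize, Rat.num_inv, Rat.den_inv_of_ne_zero h, Int.natAbs_mul, hs]
    simp [add_comm]

theorem ratSize_natCast_le (n : ℕ) : ratSize (n : ℚ) ≤ n + 1 := by
  have h : Nat.size n ≤ n := Nat.size_le.mpr Nat.lt_two_pow_self
  simp [ratSize]
  omega

theorem ratSize_one_add_le (a : ℚ) : ratSize (1 + a) ≤ 2 * ratSize a + 1 := by
  have hden : (1 + a).den = a.den := by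
    simp
  have hnum : (1 + a).num = a.den + a.num := by
    have h : ((1 + a).num : ℚ) = a.den + a.num := by
      rw [← Rat.mul_den_eq_num (1 + a), hden, ← Rat.mul_den_eq_num a]
      ring
    exact_mod_cast h
  have h : Nat.size (1 + a).num.natAbs ≤ Nat.size a.num.natAbs + Nat.size a.den + 1 := by
    rw [hnum, Nat.size_le, pow_succ, pow_add]
    have h1 := Nat.lt_size_self a.num.natAbs
    have h2 := Nat.lt_size_self a.den
    have h3 : (a.den + a.num).natAbs ≤ a.den + a.num.natAbs := by omega
    nlinarith [Nat.one_le_two_pow (n := Nat.size a.num.natAbs),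
      Nat.one_le_two_pow (n := Nat.size a.den)]
  unfold ratSize
  rw [hden]
  omega

theorem two_le_ratSize {a : ℚ} (ha : 0 < a) : 2 ≤ ratSize a := by
  have h1 : 0 < Nat.size a.num.natAbs :=
    Nat.size_pos.mpr (Int.natAbs_pos.mpr (Rat.num_pos.mpr ha).ne')
  have h2 : 0 < Nat.size a.den := Nat.size_pos.mpr a.den_pos
  unfold ratSize
  omega

/-- The extra 1 carries the induction: x < 2^a and S + 1 ≤ 2^b give x + S + 1 ≤ 2^(a+b). -/
theorem sum_add_one_le_two_pow_sum_size {ι : Type*} (s : Finset ι) (x : ι → ℕ) :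
    ∑ i ∈ s, x i + 1 ≤ 2 ^ ∑ i ∈ s, Nat.size (x i) := by
  classical
  induction s using Finset.induction_on with
  | empty => simp
  | insert a s ha ih =>
    rw [Finset.sum_insert ha, Finset.sum_insert ha, pow_add]
    have := Nat.lt_size_self (x a)
    nlinarith [Nat.one_le_two_pow (n := ∑ i ∈ s, Nat.size (x i))]

theorem prod_le_two_pow_sum_size {ι : Type*} (s : Finset ι) (x : ι → ℕ) :
    ∏ i ∈ s, x i ≤ 2 ^ ∑ i ∈ s, Nat.size (x i) := by
  rw [← Finset.prod_pow_eq_pow_sum]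
  exact Finset.prod_le_prod' fun i _ => (Nat.lt_size_self (x i)).le

theorem Rat.natCast_natAbs_num {a : ℚ} (h : 0 ≤ a) : ((a.num.natAbs : ℕ) : ℚ) = a * a.den := by
  rw [Rat.mul_den_eq_num, Nat.cast_natAbs, abs_of_nonneg (Rat.num_nonneg.mpr h)]

theorem Rat.le_natAbs_num {a : ℚ} (h : 0 ≤ a) : a ≤ (a.num.natAbs : ℚ) := by
  rw [Rat.natCast_natAbs_num h]
  exact le_mul_of_one_le_right h (by exact_mod_cast a.den_pos)

theorem ratSize_le_of_den_le {a : ℚ} {L : ℕ} (h0 : 0 ≤ a) (ha : a ≤ 2 ^ L) (hd : a.den ≤ 2 ^ L) :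
    ratSize a ≤ 3 * L + 2 := by
  have h1 : Nat.size a.den ≤ L + 1 :=
    Nat.size_le.mpr (hd.trans_lt (Nat.pow_lt_pow_right one_lt_two (Nat.lt_succ_self L)))
  have h2 : Nat.size a.num.natAbs ≤ 2 * L + 1 := by
    rw [Nat.size_le]
    refine lt_of_le_of_lt ?_ (Nat.pow_lt_pow_right one_lt_two (Nat.lt_succ_self (2 * L)))
    have : ((a.num.natAbs : ℕ) : ℚ) ≤ 2 ^ (2 * L) := by
      rw [Rat.natCast_natAbs_num h0, two_mul, pow_add]
      exact mul_le_mul ha (by exact_mod_cast hd) (by positivity) (by positivity)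
    exact_mod_cast this
  unfold ratSize
  omega

theorem Rat.add_den_dvd_of_dvd {a b : ℚ} {D : ℕ} (ha : a.den ∣ D) (hb : b.den ∣ D) :
    (a + b).den ∣ D :=
  (Rat.add_den_dvd_lcm a b).trans (Nat.lcm_dvd ha hb)

theorem Rat.sum_den_dvd_of_dvd {ι : Type*} (s : Finset ι) (x : ι → ℚ) {D : ℕ}
    (h : ∀ i ∈ s, (x i).den ∣ D) : (∑ i ∈ s, x i).den ∣ D := by
  classical
  induction s using Finset.induction_on with
  | empty => simp
  | insert a s ha ih =>
    rw [Finset.sum_insert ha]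
    exact Rat.add_den_dvd_of_dvd (h a (Finset.mem_insert_self a s))
      (ih fun i hi => h i (Finset.mem_insert_of_mem hi))

/-! ### Values and running times of monadic folds -/

namespace Timed

theorem pure_val {α : Type} (a : α) : (pure a : Timed α).val = a := rfl

theorem pure_time {α : Type} (a : α) : (pure a : Timed α).time = 0 := rfl

theorem bind_val {α β : Type} (x : Timed α) (g : α → Timed β) :
    (x >>= g).val = (g x.val).val := rfl

theorem bind_time {α β : Type} (x : Timed α) (g : α → Timed β) :
    (x >>= g).time = x.time + (g x.val).time := rfl

theorem foldlM_add_val {α β : Type} [AddMonoid β] (g : β → α → Timed β) (w : α → β)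
    (hg : ∀ b x, (g b x).val = b + w x) (l : List α) (b : β) :
    (l.foldlM g b).val = b + (l.map w).sum := by
  induction l generalizing b with
  | nil => simp [pure_val]
  | cons x l ih => rw [List.foldlM_cons, bind_val, ih, hg, List.map_cons, List.sum_cons, add_assoc]

/-- Running time of an accumulation of non-negative rationals with denominators dividing `D`. -/
theorem foldlM_add_time_le {α : Type} (g : ℚ → α → Timed ℚ) (w : α → ℚ) {D c : ℕ} {B : ℚ}
    (hg : ∀ b x, (g b x).val = b + w x) (l : List α) (hw : ∀ x ∈ l, 0 ≤ w x)
    (hd : ∀ x ∈ l, (w x).den ∣ D)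
    (hc : ∀ b, ∀ x ∈ l, 0 ≤ b → b + w x ≤ B → b.den ∣ D → (g b x).time ≤ c) (b : ℚ)
    (hb : 0 ≤ b) (hB : b + (l.map w).sum ≤ B) (hbD : b.den ∣ D) :
    (l.foldlM g b).time ≤ l.length * c := by
  induction l generalizing b with
  | nil => simp [pure_time]
  | cons x l ih =>
    rw [List.map_cons, List.sum_cons, ← add_assoc] at hB
    have hx := hw x List.mem_cons_self
    have hs : 0 ≤ (l.map w).sum := by
      refine List.sum_nonneg fun y hy => ?_
      obtain ⟨z, hz, rfl⟩ := List.mem_map.mp hy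
      exact hw z (List.mem_cons_of_mem x hz)
    have h1 := hc b x List.mem_cons_self hb (by linarith) hbD
    have h2 := ih (fun y hy => hw y (List.mem_cons_of_mem x hy))
      (fun y hy => hd y (List.mem_cons_of_mem x hy))
      (fun a y hy => hc a y (List.mem_cons_of_mem x hy)) (b + w x) (by linarith) hB
      (Rat.add_den_dvd_of_dvd hbD (hd x List.mem_cons_self))
    rw [List.foldlM_cons, bind_time, hg, List.length_cons, Nat.succ_mul]
    omega

theorem foldlM_time_of_const {α β : Type} (g : β → α → Timed β) {c : ℕ}
    (hg : ∀ b x, (g b x).time = c) (l : List α) (b : β) :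
    (l.foldlM g b).time = l.length * c := by
  induction l generalizing b with
  | nil => simp [pure_time]
  | cons x l ih =>
    rw [List.foldlM_cons, bind_time, hg, ih, List.length_cons, Nat.succ_mul, add_comm]

end Timed

/-! ### Consequences of the LP on a single resource -/

namespace LPscFeasible

variable {N : ℕ} {f f' : ℕ → ℚ} {lam : ℚ}

theorem le_succ (h : LPscFeasible N f f' lam) {n : ℕ} (hn : 1 ≤ n) (hN : n ≤ N) :
    f' n ≤ f' (n + 1) := h.mono n hn hN

theorem lam_mul_nonneg (h : LPscFeasible N f f' lam) {n : ℕ} (hn : n ≤ N) :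
    0 ≤ lam * ((n : ℚ) * f n) := by
  rcases Nat.eq_zero_or_pos n with rfl | hpos
  · simp
  have h1 := h.smooth 0 (Nat.zero_le N) n hn
  have h2 : 0 ≤ f' 1 := h.nonneg 1 (hpos.trans_le hn)
  have h3 : 0 ≤ (n : ℚ) * f' 1 := by positivity
  simp only [Nat.cast_zero, zero_mul, zero_add, add_zero] at h1
  linarith

/-- Every marginal cost `f' i` with `i ≤ n` is at most `lam * h n`. -/
theorem marginal_le (h : LPscFeasible N f f' lam) (hf : ∀ n, 0 ≤ f n) {i n : ℕ} (hi : 1 ≤ i)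
    (hin : i ≤ n) (hn : n ≤ N) : f' i ≤ lam * ((n : ℚ) * f n) := by
  obtain ⟨j, rfl⟩ : ∃ j, i = j + 1 := ⟨i - 1, by omega⟩
  have h1 := h.smooth j (by omega) n hn
  have h2 : 0 ≤ f' (j + 1) := h.nonneg _ (by omega)
  have h3 : (j : ℚ) * f' j ≤ j * f' (j + 1) := by
    rcases Nat.eq_zero_or_pos j with rfl | hj
    · simp
    · exact mul_le_mul_of_nonneg_left (h.le_succ hj (by omega)) (by positivity)
  have h4 : ((j : ℚ) + 1) ≤ n := by exact_mod_cast hin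
  have h5 : 0 ≤ (j : ℚ) * f j := mul_nonneg (by positivity) (hf j)
  -- The constraint leaves (n - j) f'(j+1) ≤ lam * h n, and n - j ≥ 1.
  nlinarith

theorem sum_marginal_le (h : LPscFeasible N f f' lam) (hf : ∀ n, 0 ≤ f n) {n : ℕ} (hn : n ≤ N) :
    ∑ i ∈ Finset.Icc 1 n, f' i ≤ N * (lam * ((n : ℚ) * f n)) := by
  have h1 : ∑ i ∈ Finset.Icc 1 n, f' i ≤ (Finset.Icc 1 n).card • (lam * ((n : ℚ) * f n)) :=
    Finset.sum_le_card_nsmul _ _ _ fun i hi => by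
      rw [Finset.mem_Icc] at hi
      exact h.marginal_le hf hi.1 hi.2 hn
  rw [Nat.card_Icc, Nat.add_sub_cancel, nsmul_eq_mul] at h1
  exact h1.trans (mul_le_mul_of_nonneg_right (by exact_mod_cast hn) (h.lam_mul_nonneg hn))

/-- If one player enters or leaves a resource, the change of the cost is controlled by the change
of the pseudo-potential. -/
theorem cost_le_of_move (h : LPscFeasible N f f' lam) (n n' : ℕ) (a b : Prop) [Decidable a]
    [Decidable b] (hn : n ≤ N) (hn' : n' ≤ N)
    (hnn : n' + (if a then 1 else 0) = n + (if b then 1 else 0)) :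
    (n : ℚ) * f n ≤ lam * ((n' : ℚ) * f n') +
      (∑ i ∈ Finset.Icc 1 n, f' i - ∑ i ∈ Finset.Icc 1 n', f' i) := by
  -- Monotonicity of `f'` starts at 1, so for k = 0 the coefficient has to vanish.
  have hmono (k : ℕ) (hk : k ≤ N) (c : ℚ) (hc : 0 ≤ c) (hck : k = 0 → c = 0) :
      c * f' k ≤ c * f' (k + 1) := by
    rcases Nat.eq_zero_or_pos k with hk0 | hk0
    · rw [hck hk0, zero_mul, zero_mul]
    · exact mul_le_mul_of_nonneg_left (h.le_succ hk0 hk) hc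
  have same : n' = n → (n : ℚ) * f n ≤ lam * ((n' : ℚ) * f n') +
      (∑ i ∈ Finset.Icc 1 n, f' i - ∑ i ∈ Finset.Icc 1 n', f' i) := by
    rintro rfl
    have h1 := h.smooth n' hn n' hn
    have h2 := hmono n' hn n' (by positivity) (by rintro rfl; simp)
    linarith
  by_cases ha : a <;> by_cases hb : b <;> simp only [ha, hb, if_true, if_false] at hnn
  · exact same (by omega)
  · obtain rfl : n = n' + 1 := by omega
    rw [Finset.sum_Icc_succ_top (by omega)]
    have h1 := h.smooth (n' + 1) hn n' hn'
    have h2 := hmono (n' + 1) hn n' (by positivity) (by omega)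
    push_cast at h1 ⊢
    linarith
  · obtain rfl : n' = n + 1 := by omega
    rw [Finset.sum_Icc_succ_top (by omega)]
    have h1 := h.smooth n hn (n + 1) hn'
    have h2 := hmono n hn n (by positivity) (by rintro rfl; simp)
    push_cast at h1 ⊢
    linarith
  · exact same (by omega)

/-- Equality holds unless the resource is in both the old and the new strategy; then the left side
is 0 and the right side is a non-negative increment of `f'`. -/
theorem potential_sub_le_of_move (h : LPscFeasible N f f' lam) (n n' : ℕ) (a b : Prop)
    [Decidable a] [Decidable b] (hn : n ≤ N) (han : a → 1 ≤ n)
    (hnn : n' + (if a then 1 else 0) = n + (if b then 1 else 0)) :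
    ∑ i ∈ Finset.Icc 1 n', f' i - ∑ i ∈ Finset.Icc 1 n, f' i ≤
      (if b then f' (n + 1) else 0) - (if a then f' n else 0) := by
  by_cases ha : a <;> by_cases hb : b <;> simp only [ha, hb, if_true, if_false] at hnn ⊢
  · obtain rfl : n' = n := by omega
    have := h.le_succ (han ha) hn
    linarith
  · obtain rfl : n = n' + 1 := by omega
    rw [Finset.sum_Icc_succ_top (by omega)]
    linarith
  · obtain rfl : n' = n + 1 := by omega
    rw [Finset.sum_Icc_succ_top (by omega)]
    linarith
  · obtain rfl : n' = n := by omega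
    linarith

end LPscFeasible

theorem maxLam_nonneg {m : ℕ} (lam : Fin m → ℚ) : 0 ≤ maxLam lam :=
  (Finset.le_fold_max _).mpr (Or.inl le_rfl)

theorem le_maxLam {m : ℕ} (lam : Fin m → ℚ) (e : Fin m) : lam e ≤ maxLam lam :=
  (Finset.le_fold_max _).mpr (Or.inr ⟨e, Finset.mem_univ e, le_rfl⟩)

/-- Lets the single multiplier `maxLam` serve all resources; it works because h ≥ 0. -/
theorem LPscFeasible.weaken {N : ℕ} {f f' : ℕ → ℚ} {lam mu : ℚ} (h : LPscFeasible N f f' lam)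
    (hf : ∀ n, 0 ≤ f n) (hmu : lam ≤ mu) : LPscFeasible N f f' mu where
  smooth n hn m hm := by
    have h1 := h.smooth n hn m hm
    have h2 : lam * ((m : ℚ) * f m) ≤ mu * ((m : ℚ) * f m) :=
      mul_le_mul_of_nonneg_right hmu (mul_nonneg (by positivity) (hf m))
    linarith
  nonneg := h.nonneg
  mono := h.mono

/-! ### Social cost against pseudo-potential -/

namespace CongestionGame

variable (G : CongestionGame)

theorem load_eq_sum (s : G.State) (e : Fin G.m) :
    G.load s e = ∑ u, if e ∈ G.strat u (s u) then 1 else 0 := by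
  rw [load, Finset.card_filter]

theorem load_le (s : G.State) (e : Fin G.m) : G.load s e ≤ G.N :=
  (Finset.card_filter_le _ _).trans (by simp)

theorem one_le_load {s : G.State} {u : Fin G.N} {e : Fin G.m} (h : e ∈ G.strat u (s u)) :
    1 ≤ G.load s e :=
  Finset.card_pos.mpr ⟨u, by simpa using h⟩

/-- The additive form avoids truncated subtraction. -/
theorem load_deviate (s : G.State) (u : Fin G.N) (j : Fin (G.k u)) (e : Fin G.m) :
    G.load (G.deviate s u j) e + (if e ∈ G.strat u (s u) then 1 else 0) =
      G.load s e + (if e ∈ G.strat u j then 1 else 0) := by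
  rw [load_eq_sum, load_eq_sum, ← Finset.add_sum_erase _ _ (Finset.mem_univ u),
    ← Finset.add_sum_erase (a := u) Finset.univ (fun v => if e ∈ G.strat v (s v) then 1 else 0)
      (Finset.mem_univ u)]
  have h : ∑ v ∈ Finset.univ.erase u, (if e ∈ G.strat v (G.deviate s u j v) then 1 else 0) =
      ∑ v ∈ Finset.univ.erase u, if e ∈ G.strat v (s v) then 1 else 0 :=
    Finset.sum_congr rfl fun v hv => by
      rw [deviate, Function.update_of_ne (Finset.ne_of_mem_erase hv)]
  rw [h, deviate, Function.update_self]
  ring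

theorem sum_players_sum_strategy (s : G.State) (w : Fin G.m → ℚ) :
    ∑ u, ∑ e, (if e ∈ G.strat u (s u) then w e else 0) = ∑ e, (G.load s e : ℚ) * w e := by
  rw [Finset.sum_comm]
  refine Finset.sum_congr rfl fun e _ => ?_
  rw [load_eq_sum, Nat.cast_sum, Finset.sum_mul]
  refine Finset.sum_congr rfl fun u _ => ?_
  split_ifs <;> simp

theorem socialCost_eq (s : G.State) :
    G.socialCost s = ∑ e, (G.load s e : ℚ) * G.f e (G.load s e) := by
  rw [← G.sum_players_sum_strategy s fun e => G.f e (G.load s e)]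
  refine Finset.sum_congr rfl fun u _ => ?_
  rw [playerCost, Finset.sum_ite_mem, Finset.univ_inter]

theorem socialCost_nonneg (s : G.State) : 0 ≤ G.socialCost s :=
  Finset.sum_nonneg fun _ _ => Finset.sum_nonneg fun _ _ => G.f_nonneg _ _

variable {G} {f' : Fin G.m → ℕ → ℚ} {lam : ℚ}

theorem zeta_le (h : ∀ e, LPscFeasible G.N (G.f e) (f' e) lam) (s : G.State) :
    G.zeta f' s ≤ G.N * (lam * G.socialCost s) := by
  rw [socialCost_eq, Finset.mul_sum, Finset.mul_sum]
  exact Finset.sum_le_sum fun e _ => (h e).sum_marginal_le (G.f_nonneg e) (G.load_le s e)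

theorem zeta_nonneg (h : ∀ e, ∀ n ≤ G.N, 0 ≤ f' e n) (s : G.State) : 0 ≤ G.zeta f' s :=
  Finset.sum_nonneg fun e _ => Finset.sum_nonneg fun i hi =>
    h e i ((Finset.mem_Icc.mp hi).2.trans (G.load_le s e))

theorem socialCost_le_deviate (h : ∀ e, LPscFeasible G.N (G.f e) (f' e) lam) (s : G.State)
    (u : Fin G.N) (j : Fin (G.k u)) :
    G.socialCost s ≤ lam * G.socialCost (G.deviate s u j) +
      (G.zeta f' s - G.zeta f' (G.deviate s u j)) := by
  rw [socialCost_eq, socialCost_eq, Finset.mul_sum, zeta, zeta, ← Finset.sum_sub_distrib,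
    ← Finset.sum_add_distrib]
  exact Finset.sum_le_sum fun e _ => (h e).cost_le_of_move _ _ _ _ (G.load_le _ e) (G.load_le _ e)
    (G.load_deviate s u j e)

/-- Smoothness argument: double counting turns the players' marginal costs into the terms m f'(n+1)
and n f'(n) of the LP, with n and m the loads in `s` and `t`. -/
theorem socialCost_le_sum_deviate (h : ∀ e, LPscFeasible G.N (G.f e) (f' e) lam)
    (s t : G.State) :
    G.socialCost s ≤ lam * G.socialCost t +
      ∑ u, (G.zeta f' s - G.zeta f' (G.deviate s u (t u))) := by
  have h1 : ∑ u, (G.zeta f' (G.deviate s u (t u)) - G.zeta f' s) ≤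
      ∑ e, (G.load t e : ℚ) * f' e (G.load s e + 1) -
        ∑ e, (G.load s e : ℚ) * f' e (G.load s e) := by
    rw [← sum_players_sum_strategy, ← sum_players_sum_strategy, ← Finset.sum_sub_distrib]
    refine Finset.sum_le_sum fun u _ => ?_
    rw [zeta, zeta, ← Finset.sum_sub_distrib, ← Finset.sum_sub_distrib]
    exact Finset.sum_le_sum fun e _ => (h e).potential_sub_le_of_move _ _ _ _ (G.load_le _ e)
      (fun he => G.one_le_load he) (G.load_deviate s u (t u) e)
  have h2 : G.socialCost s ≤ lam * G.socialCost t -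
      ∑ e, (G.load t e : ℚ) * f' e (G.load s e + 1) +
        ∑ e, (G.load s e : ℚ) * f' e (G.load s e) := by
    rw [socialCost_eq, socialCost_eq, Finset.mul_sum, ← Finset.sum_sub_distrib,
      ← Finset.sum_add_distrib]
    exact Finset.sum_le_sum fun e _ => (h e).smooth _ (G.load_le _ e) _ (G.load_le _ e)
  rw [Finset.sum_sub_distrib] at h1 ⊢
  linarith

theorem isApproxLocalOpt_socialCost (h : ∀ e, LPscFeasible G.N (G.f e) (f' e) lam)
    (hlam : 0 ≤ lam) {ε : ℚ} (hε : 0 < ε) {s : G.State}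
    (hs : G.IsApproxLocalOpt (G.zeta f') (1 + ε / (G.N + 1)) s) :
    G.IsApproxLocalOpt G.socialCost (lam * (1 + ε)) s := by
  intro u j
  have h1 := socialCost_le_deviate h s u j
  have h2 := hs u j
  have h3 := zeta_le h (G.deviate s u j)
  have h4 : 0 ≤ lam * G.socialCost (G.deviate s u j) := mul_nonneg hlam (G.socialCost_nonneg _)
  have h5 : ε / (G.N + 1) * G.zeta f' (G.deviate s u j) ≤
      ε * (lam * G.socialCost (G.deviate s u j)) := by
    rw [div_mul_eq_mul_div, div_le_iff₀ (by positivity), mul_assoc]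
    exact mul_le_mul_of_nonneg_left (by linarith) hε.le
  linarith

theorem socialCost_le_of_isApproxLocalOpt (h : ∀ e, LPscFeasible G.N (G.f e) (f' e) lam)
    (hlam : 0 ≤ lam) {ε : ℚ} (hε : 0 < ε) {s : G.State}
    (hs : G.IsApproxLocalOpt (G.zeta f')
      (1 + ε / ((1 + ε) * (G.N + 1) ^ 2 * (⌈lam⌉₊ + 1))) s) (t : G.State) :
    G.socialCost s ≤ lam * (1 + ε) * G.socialCost t := by
  set δ : ℚ := ε / ((1 + ε) * (G.N + 1) ^ 2 * (⌈lam⌉₊ + 1)) with hδ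
  have hδ0 : 0 < δ := by positivity
  have hc := G.socialCost_nonneg s
  have hz : 0 ≤ G.zeta f' s := zeta_nonneg (fun e => (h e).nonneg) s
  have h1 := socialCost_le_sum_deviate h s t
  have h2 : ∑ u, (G.zeta f' s - G.zeta f' (G.deviate s u (t u))) ≤ G.N * (δ * G.zeta f' s) := by
    have h3 : ∑ u, (G.zeta f' s - G.zeta f' (G.deviate s u (t u))) ≤
        (Finset.univ : Finset (Fin G.N)).card • (δ * G.zeta f' s) :=
      Finset.sum_le_card_nsmul _ _ _ fun u _ => by
        have h4 := hs u (t u)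
        rcases le_total (G.zeta f' (G.deviate s u (t u))) (G.zeta f' s) with h5 | h5
        · have := mul_le_mul_of_nonneg_left h5 hδ0.le
          linarith
        · have := mul_nonneg hδ0.le hz
          linarith
    simpa using h3
  -- One factor N counts the deviating players, the other comes from `zeta_le`; `δ` is chosen so
  -- that the product is ε/(1+ε), leaving c(s)/(1+ε) after absorption.
  have h3 : (G.N : ℚ) * (δ * G.zeta f' s) ≤ ε / (1 + ε) * G.socialCost s := by
    have hlc : lam ≤ ⌈lam⌉₊ + 1 := (Nat.le_ceil lam).trans (by linarith)
    calc (G.N : ℚ) * (δ * G.zeta f' s) ≤ G.N * (δ * (G.N * (lam * G.socialCost s))) := by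
          gcongr
          exact zeta_le h s
      _ ≤ (G.N + 1) * (δ * ((G.N + 1) * ((⌈lam⌉₊ + 1) * G.socialCost s))) := by
          gcongr <;> linarith
      _ = ε / (1 + ε) * G.socialCost s := by
          rw [hδ]
          field_simp
  have h4 : G.socialCost s ≤ lam * G.socialCost t + ε / (1 + ε) * G.socialCost s := by linarith
  rw [div_mul_eq_mul_div, ← sub_le_iff_le_add, le_iff_lt_or_eq] at h4
  have h6 : G.socialCost s - ε * G.socialCost s / (1 + ε) = G.socialCost s / (1 + ε) := by
    field_simp
    ring
  rw [h6, ← le_iff_lt_or_eq, div_le_iff₀ (by positivity)] at h4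
  linarith

end CongestionGame

/-! ### Magnitude and denominators of the pseudo-potential -/

namespace CongestionGame

variable (G : CongestionGame)

/-- A common multiple of the denominators of all entries of the tables of `f'`. -/
def commonDen (f' : Fin G.m → ℕ → ℚ) : ℕ :=
  ∏ p ∈ (Finset.univ : Finset (Fin G.m)) ×ˢ Finset.Icc 1 G.N, (f' p.1 p.2).den

/-- The sum of all entries of the tables of `f'`. -/
def tableSum (f' : Fin G.m → ℕ → ℚ) : ℚ := ∑ e, ∑ i ∈ Finset.Icc 1 G.N, f' e i

theorem sum_ratSize_le (f' : Fin G.m → ℕ → ℚ) :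
    ∑ p ∈ (Finset.univ : Finset (Fin G.m)) ×ˢ Finset.Icc 1 G.N, ratSize (f' p.1 p.2) ≤
      G.encLength f' := by
  rw [Finset.sum_product]
  exact (Finset.sum_le_sum fun e _ => Finset.sum_le_sum fun i _ => Nat.le_add_left _ _).trans
    (Nat.le_add_left _ _)

theorem commonDen_le (f' : Fin G.m → ℕ → ℚ) : G.commonDen f' ≤ 2 ^ G.encLength f' :=
  (prod_le_two_pow_sum_size _ _).trans <| Nat.pow_le_pow_right two_pos <|
    (Finset.sum_le_sum fun _ _ => Nat.le_add_left _ _).trans (G.sum_ratSize_le f')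

theorem commonDen_pos (f' : Fin G.m → ℕ → ℚ) : 0 < G.commonDen f' :=
  Finset.prod_pos fun _ _ => Rat.den_pos _

theorem den_dvd_commonDen (f' : Fin G.m → ℕ → ℚ) (e : Fin G.m) {i : ℕ} (hi : 1 ≤ i)
    (hN : i ≤ G.N) : (f' e i).den ∣ G.commonDen f' :=
  Finset.dvd_prod_of_mem (fun p : Fin G.m × ℕ => (f' p.1 p.2).den) (a := (e, i))
    (by simp [hi, hN])

theorem sum_Icc_den_dvd_commonDen (f' : Fin G.m → ℕ → ℚ) (e : Fin G.m) {n : ℕ} (hN : n ≤ G.N) :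
    (∑ i ∈ Finset.Icc 1 n, f' e i).den ∣ G.commonDen f' :=
  Rat.sum_den_dvd_of_dvd _ _ fun i hi => by
    rw [Finset.mem_Icc] at hi
    exact G.den_dvd_commonDen f' e hi.1 (hi.2.trans hN)

theorem zeta_den_le (f' : Fin G.m → ℕ → ℚ) (s : G.State) :
    (G.zeta f' s).den ≤ 2 ^ G.encLength f' :=
  (Nat.le_of_dvd (G.commonDen_pos f') (Rat.sum_den_dvd_of_dvd _ _ fun e _ =>
    G.sum_Icc_den_dvd_commonDen f' e (G.load_le s e))).trans (G.commonDen_le f')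

variable {G} {f' : Fin G.m → ℕ → ℚ}

theorem tableSum_le (h : ∀ e, ∀ n ≤ G.N, 0 ≤ f' e n) :
    G.tableSum f' ≤ 2 ^ G.encLength f' := by
  have h1 : G.tableSum f' ≤ ((∑ p ∈ (Finset.univ : Finset (Fin G.m)) ×ˢ Finset.Icc 1 G.N,
      (f' p.1 p.2).num.natAbs : ℕ) : ℚ) := by
    rw [Nat.cast_sum, Finset.sum_product]
    exact Finset.sum_le_sum fun e _ => Finset.sum_le_sum fun i hi =>
      Rat.le_natAbs_num (h e i (Finset.mem_Icc.mp hi).2)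
  refine h1.trans ?_
  have h2 := sum_add_one_le_two_pow_sum_size
    ((Finset.univ : Finset (Fin G.m)) ×ˢ Finset.Icc 1 G.N) fun p => (f' p.1 p.2).num.natAbs
  have h3 := Nat.pow_le_pow_right two_pos <|
    (Finset.sum_le_sum fun p _ => Nat.le_add_right (f' p.1 p.2).num.natAbs.size
      (f' p.1 p.2).den.size).trans (G.sum_ratSize_le f')
  exact_mod_cast (Nat.le_succ _).trans (h2.trans h3)

theorem sum_Icc_nonneg (h : ∀ e, ∀ n ≤ G.N, 0 ≤ f' e n) (e : Fin G.m) {n : ℕ} (hn : n ≤ G.N) :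
    0 ≤ ∑ i ∈ Finset.Icc 1 n, f' e i :=
  Finset.sum_nonneg fun i hi => h e i ((Finset.mem_Icc.mp hi).2.trans hn)

theorem zeta_le_tableSum (h : ∀ e, ∀ n ≤ G.N, 0 ≤ f' e n) (s : G.State) :
    G.zeta f' s ≤ G.tableSum f' :=
  Finset.sum_le_sum fun e _ => Finset.sum_le_sum_of_subset_of_nonneg
    (Finset.Icc_subset_Icc_right (G.load_le s e))
    fun i hi _ => h e i (Finset.mem_Icc.mp hi).2

theorem ratSize_zeta_le (h : ∀ e, ∀ n ≤ G.N, 0 ≤ f' e n) (s : G.State) :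
    ratSize (G.zeta f' s) ≤ 3 * G.encLength f' + 2 :=
  ratSize_le_of_den_le (zeta_nonneg h s) ((zeta_le_tableSum h s).trans (tableSum_le h))
    (G.zeta_den_le f' s)

variable (G) in
theorem N_add_m_le (f' : Fin G.m → ℕ → ℚ) : G.N + G.m ≤ G.encLength f' := by
  unfold encLength
  omega

variable (G) in
theorem length_moves_le (f' : Fin G.m → ℕ → ℚ) : G.moves.length ≤ G.encLength f' := by
  have h1 : G.moves.length = ∑ u, G.k u := by
    simp [moves, List.length_flatMap, ← List.ofFn_eq_map, List.sum_ofFn]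
  have h2 : ∑ u, G.k u ≤ ∑ u, G.k u * (G.m + 1) :=
    Finset.sum_le_sum fun u _ => Nat.le_mul_of_pos_right _ (Nat.succ_pos _)
  unfold encLength
  omega

theorem mem_moves (u : Fin G.N) (j : Fin (G.k u)) :
    (⟨u, j⟩ : (u : Fin G.N) × Fin (G.k u)) ∈ G.moves := by
  simp [moves]

/-! ### Correctness and cost of one round -/

theorem loadT_time (s : G.State) (e : Fin G.m) :
    (G.loadT f' s e).time = G.N * G.encLength f' := by
  rw [loadT, Timed.foldlM_time_of_const (c := G.encLength f'), List.length_finRange]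
  intro b x
  rfl

theorem loadT_val (s : G.State) (e : Fin G.m) : (G.loadT f' s e).val = G.load s e := by
  rw [loadT, Timed.foldlM_add_val _ fun u => if e ∈ G.strat u (s u) then 1 else 0,
    ← List.ofFn_eq_map, List.sum_ofFn, zero_add, load_eq_sum]
  intro b u
  simp only [Timed.bind_val, Timed.pure_val]
  split_ifs <;> rfl

variable (G) in
/-- The part of `zetaT` that adds the contribution of one resource. -/
def resourceT (f' : Fin G.m → ℕ → ℚ) (s : G.State) (acc : ℚ) (e : Fin G.m) : Timed ℚ := do
  Timed.tick (G.encLength f')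
  let n ← G.loadT f' s e
  (List.range n).foldlM (fun a i => do
    Timed.tick (G.encLength f')
    Timed.add a (f' e (i + 1))) acc

theorem sum_map_range_eq (w : ℕ → ℚ) (n : ℕ) :
    ((List.range n).map fun i => w (i + 1)).sum = ∑ i ∈ Finset.Icc 1 n, w i := by
  induction n with
  | zero => simp
  | succ n ih => simp [List.range_succ, ih, Finset.sum_Icc_succ_top]

theorem resourceT_val (s : G.State) (acc : ℚ) (e : Fin G.m) :
    (G.resourceT f' s acc e).val = acc + ∑ i ∈ Finset.Icc 1 (G.load s e), f' e i := by
  rw [resourceT, Timed.bind_val, Timed.bind_val, loadT_val,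
    Timed.foldlM_add_val _ (fun i => f' e (i + 1)) fun _ _ => rfl, sum_map_range_eq]

theorem zetaT_val (s : G.State) : (G.zetaT f' s).val = G.zeta f' s := by
  change ((List.finRange G.m).foldlM (G.resourceT f' s) 0).val = _
  rw [Timed.foldlM_add_val _ _ (resourceT_val s), zero_add, ← List.ofFn_eq_map, List.sum_ofFn,
    zeta]

/-- The hypotheses on `acc` are the fold invariant that keeps every intermediate sum of size at most
3M. The charges are M for the tick, M² for the load and M(M + 36M²) for the additions. -/
theorem resourceT_time_le (h : ∀ e, ∀ n ≤ G.N, 0 ≤ f' e n) {M : ℕ} (hM : G.encLength f' < M)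
    (s : G.State) (acc : ℚ) (e : Fin G.m) (h0 : 0 ≤ acc)
    (hB : acc + ∑ i ∈ Finset.Icc 1 (G.load s e), f' e i ≤ 2 ^ G.encLength f')
    (hD : acc.den ∣ G.commonDen f') : (G.resourceT f' s acc e).time ≤ 39 * M ^ 3 := by
  have hN := G.N_add_m_le f'
  have hload := G.load_le s e
  have hsize {q : ℚ} (hq : 0 ≤ q) (hq1 : q ≤ 2 ^ G.encLength f')
      (hqD : q.den ∣ G.commonDen f') : ratSize q ≤ 3 * M := by
    have := ratSize_le_of_den_le hq hq1
      ((Nat.le_of_dvd (G.commonDen_pos f') hqD).trans (G.commonDen_le f'))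
    omega
  have hfold : ((List.range (G.load s e)).foldlM (fun a i => do
      Timed.tick (G.encLength f')
      Timed.add a (f' e (i + 1))) acc).time ≤
        (List.range (G.load s e)).length * (M + (6 * M) ^ 2) := by
    refine Timed.foldlM_add_time_le _ (fun i => f' e (i + 1)) (D := G.commonDen f')
      (B := 2 ^ G.encLength f') (fun _ _ => rfl) _ ?_ ?_ ?_ acc h0 ?_ hD
    · intro i hi
      exact h e _ (by have := List.mem_range.mp hi; omega)
    · intro i hi
      exact G.den_dvd_commonDen f' e (by omega) (by have := List.mem_range.mp hi; omega)
    · intro b i hi hb hbB hbD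
      have hi' : i + 1 ≤ G.N := by have := List.mem_range.mp hi; omega
      have hw := h e _ hi'
      have h1 := hsize hb (by linarith) hbD
      have h2 := hsize hw (by linarith) (G.den_dvd_commonDen f' e (by omega) hi')
      exact Nat.add_le_add hM.le (Nat.pow_le_pow_left (by omega) 2)
    · rwa [sum_map_range_eq]
  rw [resourceT, Timed.bind_time, Timed.bind_time, loadT_val, loadT_time]
  rw [List.length_range] at hfold
  have h1 : G.load s e * (M + (6 * M) ^ 2) ≤ M * (M + (6 * M) ^ 2) :=
    Nat.mul_le_mul_right _ (by omega)
  have h2 : G.N * G.encLength f' ≤ M * M := Nat.mul_le_mul (by omega) hM.le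
  have h3 : (Timed.tick (G.encLength f')).time ≤ M := hM.le
  have h4 : 1 ≤ M := by omega
  have h5 : M * M ≤ M * M * M := Nat.le_mul_of_pos_right _ h4
  have h6 : M ≤ M * M := Nat.le_mul_of_pos_right _ h4
  nlinarith

theorem zetaT_time_le (h : ∀ e, ∀ n ≤ G.N, 0 ≤ f' e n) {M : ℕ} (hM : G.encLength f' < M)
    (s : G.State) : (G.zetaT f' s).time ≤ 39 * M ^ 4 := by
  have hN := G.N_add_m_le f'
  have h1 : ((List.finRange G.m).foldlM (G.resourceT f' s) 0).time ≤
      (List.finRange G.m).length * (39 * M ^ 3) := by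
    refine Timed.foldlM_add_time_le _ _ (D := G.commonDen f') (B := 2 ^ G.encLength f')
      (resourceT_val s) _ (fun e _ => sum_Icc_nonneg h e (G.load_le s e))
      (fun e _ => G.sum_Icc_den_dvd_commonDen f' e (G.load_le s e))
      (fun b e _ => resourceT_time_le h hM s b e) 0 le_rfl ?_ (by simp)
    rw [zero_add, ← List.ofFn_eq_map, List.sum_ofFn]
    exact (zeta_le_tableSum h s).trans (tableSum_le h)
  rw [List.length_finRange] at h1
  calc (G.zetaT f' s).time ≤ G.m * (39 * M ^ 3) := h1
    _ ≤ M * (39 * M ^ 3) := Nat.mul_le_mul_right _ (by omega)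
    _ = 39 * M ^ 4 := by ring

theorem firstMoveT_cons_val (δ z : ℚ) (s : G.State) (u : Fin G.N) (j : Fin (G.k u))
    (l : List ((u : Fin G.N) × Fin (G.k u))) :
    (G.firstMoveT f' δ z s (⟨u, j⟩ :: l)).val =
      if (1 + δ) * G.zeta f' (G.deviate s u j) < z then some (G.deviate s u j)
      else (G.firstMoveT f' δ z s l).val := by
  simp only [firstMoveT, Timed.bind_val, zetaT_val, Timed.add, Timed.mul, Timed.lt]
  by_cases hlt : (1 + δ) * G.zeta f' (G.deviate s u j) < z <;> simp [hlt, Timed.pure_val]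

theorem firstMoveT_time_le (h : ∀ e, ∀ n ≤ G.N, 0 ≤ f' e n) {M : ℕ} (hM : G.encLength f' < M)
    {δ : ℚ} (hδ : ratSize δ ≤ M) {z : ℚ} (hz : ratSize z ≤ 3 * M) (s : G.State)
    (l : List ((u : Fin G.N) × Fin (G.k u))) :
    (G.firstMoveT f' δ z s l).time ≤ l.length * (318 * M ^ 4) := by
  induction l with
  | nil => simp [firstMoveT, Timed.pure_time]
  | cons p l ih =>
    obtain ⟨u, j⟩ := p
    have h1 := zetaT_time_le h hM (G.deviate s u j)
    have h2 : ratSize (G.zeta f' (G.deviate s u j)) ≤ 3 * M := by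
      have := ratSize_zeta_le h (G.deviate s u j)
      omega
    have h3 := ratSize_one_add_le δ
    have h4 := ratSize_mul_le (1 + δ) (G.zeta f' (G.deviate s u j))
    -- With sizes at most 3M for 1 + δ, ζ and z, the operands have total size at most 3M, 6M and 9M.
    -- All charges sum to at most 166M⁴, so 318 leaves slack.
    have hone : ratSize 1 = 2 := by simp [ratSize]
    have c1 : Timed.arithCost 1 δ ≤ (3 * M) ^ 2 := Nat.pow_le_pow_left (by omega) 2
    have c2 : Timed.arithCost (1 + δ) (G.zeta f' (G.deviate s u j)) ≤ (6 * M) ^ 2 :=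
      Nat.pow_le_pow_left (by omega) 2
    have c3 : Timed.arithCost ((1 + δ) * G.zeta f' (G.deviate s u j)) z ≤ (9 * M) ^ 2 :=
      Nat.pow_le_pow_left (by omega) 2
    have c4 : M ^ 2 ≤ M ^ 4 := Nat.pow_le_pow_right (by omega) (by norm_num)
    have c5 : M ≤ M ^ 4 := Nat.le_self_pow (by norm_num) M
    have hrest (b : Bool) : (if b = true then pure (some (G.deviate s u j))
        else G.firstMoveT f' δ z s l : Timed (Option G.State)).time ≤
          l.length * (318 * M ^ 4) := by
      cases b
      · exact ih
      · exact Nat.zero_le _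
    have h5 := hrest (decide ((1 + δ) * G.zeta f' (G.deviate s u j) < z))
    rw [← zetaT_val] at c2 c3 h5
    rw [List.length_cons, Nat.succ_mul]
    refine le_trans (Nat.add_le_add hM.le (Nat.add_le_add h1 (Nat.add_le_add c1
      (Nat.add_le_add c2 (Nat.add_le_add c3 h5))))) ?_
    linarith

theorem firstMoveT_eq_some {δ z : ℚ} {s s' : G.State} {l : List ((u : Fin G.N) × Fin (G.k u))}
    (h : (G.firstMoveT f' δ z s l).val = some s') : (1 + δ) * G.zeta f' s' < z := by
  induction l with
  | nil => simp [firstMoveT, Timed.pure_val] at h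
  | cons p l ih =>
    obtain ⟨u, j⟩ := p
    rw [firstMoveT_cons_val] at h
    split_ifs at h with hlt
    · rwa [← Option.some_inj.mp h]
    · exact ih h

theorem firstMoveT_eq_none {δ z : ℚ} {s : G.State} {l : List ((u : Fin G.N) × Fin (G.k u))}
    (h : (G.firstMoveT f' δ z s l).val = none) :
    ∀ p ∈ l, z ≤ (1 + δ) * G.zeta f' (G.deviate s p.1 p.2) := by
  induction l with
  | nil => simp
  | cons p l ih =>
    obtain ⟨u, j⟩ := p
    rw [firstMoveT_cons_val] at h
    split_ifs at h with hlt
    intro q hq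
    rcases List.mem_cons.mp hq with rfl | hq
    · exact not_lt.mp hlt
    · exact ih h q hq

theorem stepT_val (δ : ℚ) (s : G.State) :
    (G.stepT f' δ s).val = (G.firstMoveT f' δ (G.zeta f' s) s G.moves).val := by
  rw [stepT, Timed.bind_val, zetaT_val]

theorem stepT_time_le (h : ∀ e, ∀ n ≤ G.N, 0 ≤ f' e n) {M : ℕ} (hM : G.encLength f' < M)
    {δ : ℚ} (hδ : ratSize δ ≤ M) (s : G.State) : (G.stepT f' δ s).time ≤ 357 * M ^ 5 := by
  have h1 := zetaT_time_le h hM s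
  have h2 := firstMoveT_time_le h hM hδ (z := G.zeta f' s)
    (by have := ratSize_zeta_le h s; omega) s G.moves
  have h3 : G.moves.length * (318 * M ^ 4) ≤ M * (318 * M ^ 4) :=
    Nat.mul_le_mul_right _ ((G.length_moves_le f').trans hM.le)
  have h4 : M ^ 4 ≤ M ^ 5 := Nat.pow_le_pow_right (by omega) (by norm_num)
  have h5 : M * (318 * M ^ 4) = 318 * M ^ 5 := by ring
  rw [stepT, Timed.bind_time, zetaT_val]
  omega

theorem isApproxLocalOpt_of_stepT_eq_none {δ : ℚ} {s : G.State}
    (h : (G.stepT f' δ s).val = none) : G.IsApproxLocalOpt (G.zeta f') (1 + δ) s := by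
  rw [stepT_val] at h
  exact fun u j => firstMoveT_eq_none h ⟨u, j⟩ (mem_moves u j)

/-! ### Number of rounds -/

theorem one_le_zeta_mul {s : G.State} (hs : 0 < G.zeta f' s) :
    1 ≤ G.zeta f' s * 2 ^ G.encLength f' := by
  have h1 : (1 : ℚ) ≤ G.zeta f' s * (G.zeta f' s).den := by
    rw [← Rat.natCast_natAbs_num hs.le]
    exact_mod_cast Int.natAbs_pos.mpr (Rat.num_pos.mpr hs).ne'
  have h2 : ((G.zeta f' s).den : ℚ) ≤ 2 ^ G.encLength f' := by
    exact_mod_cast G.zeta_den_le f' s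
  nlinarith

/-- `K` is a budget of moves: each move uses up one factor 1 + δ. At K = 0 the bound is below the
least positive value of ζ, so ζ = 0 and no move can improve. -/
theorem exists_localSearch_of_zeta_lt (h : ∀ e, ∀ n ≤ G.N, 0 ≤ f' e n) {M : ℕ}
    (hM : G.encLength f' < M) {δ : ℚ} (hδ0 : 0 < δ) (hδ : ratSize δ ≤ M) (K : ℕ) (s : G.State)
    (hs : G.zeta f' s * 2 ^ G.encLength f' < (1 + δ) ^ K) :
    ∃ (t : G.State) (T : ℕ), G.LocalSearch f' δ s t T ∧ T ≤ (K + 1) * (357 * M ^ 5) ∧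
      G.IsApproxLocalOpt (G.zeta f') (1 + δ) t := by
  induction K generalizing s with
  | zero =>
    cases hv : (G.stepT f' δ s).val with
    | none =>
      refine ⟨s, _, .halt s hv, ?_, isApproxLocalOpt_of_stepT_eq_none hv⟩
      simpa using stepT_time_le h hM hδ s
    | some s' =>
      rw [stepT_val] at hv
      have h1 := firstMoveT_eq_some hv
      have h2 : 0 ≤ (1 + δ) * G.zeta f' s' := mul_nonneg (by linarith) (zeta_nonneg h s')
      have h3 := one_le_zeta_mul (h2.trans_lt h1)
      rw [pow_zero] at hs
      exact absurd hs h3.not_gt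
  | succ K ih =>
    have ht := stepT_time_le h hM hδ s
    cases hv : (G.stepT f' δ s).val with
    | none =>
      refine ⟨s, _, .halt s hv, ?_, isApproxLocalOpt_of_stepT_eq_none hv⟩
      exact ht.trans (Nat.le_mul_of_pos_left _ (Nat.succ_pos _))
    | some s' =>
      have h1 : (1 + δ) * G.zeta f' s' < G.zeta f' s := by
        rw [stepT_val] at hv
        exact firstMoveT_eq_some hv
      have h2 : G.zeta f' s' * 2 ^ G.encLength f' < (1 + δ) ^ K := by
        have h3 := mul_lt_mul_of_pos_right h1 (show (0 : ℚ) < 2 ^ G.encLength f' by positivity)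
        rw [pow_succ] at hs
        have h4 : (1 + δ) * (G.zeta f' s' * 2 ^ G.encLength f') < (1 + δ) * (1 + δ) ^ K := by
          linarith
        exact lt_of_mul_lt_mul_left h4 (by linarith)
      obtain ⟨t, T, hT, hTle, hopt⟩ := ih s' h2
      refine ⟨t, _, .move s s' t T hv hT, ?_, hopt⟩
      rw [Nat.succ_mul (K + 1)]
      omega

/-- The local search halts after polynomially many bit operations. -/
theorem exists_localSearch (h : ∀ e, ∀ n ≤ G.N, 0 ≤ f' e n) {M : ℕ} (hM : G.encLength f' < M)
    {δ : ℚ} (hδ0 : 0 < δ) (hδ : ratSize δ ≤ M) (hδM : 1 / δ ≤ M) (s : G.State) :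
    ∃ (t : G.State) (T : ℕ), G.LocalSearch f' δ s t T ∧ T ≤ 714 * M ^ 7 ∧
      G.IsApproxLocalOpt (G.zeta f') (1 + δ) t := by
  -- Bernoulli: since Mδ ≥ 1, any M moves at least halve ζ.
  have hpow : (2 : ℚ) ≤ (1 + δ) ^ M := by
    have h1 := one_add_mul_le_pow (a := δ) (by linarith) M
    have h2 : 1 ≤ (M : ℚ) * δ := by rwa [div_le_iff₀ hδ0] at hδM
    linarith
  have hs : G.zeta f' s * 2 ^ G.encLength f' < (1 + δ) ^ (M * (2 * G.encLength f' + 1)) := by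
    have h1 := (zeta_le_tableSum h s).trans (tableSum_le h)
    calc G.zeta f' s * 2 ^ G.encLength f' ≤ 2 ^ G.encLength f' * 2 ^ G.encLength f' := by gcongr
      _ = 2 ^ (2 * G.encLength f') := by rw [← pow_add, two_mul]
      _ < 2 ^ (2 * G.encLength f' + 1) := pow_lt_pow_right₀ one_lt_two (Nat.lt_succ_self _)
      _ ≤ ((1 + δ) ^ M) ^ (2 * G.encLength f' + 1) := by gcongr
      _ = _ := by rw [pow_mul]
  obtain ⟨t, T, hT, hTle, hopt⟩ := exists_localSearch_of_zeta_lt h hM hδ0 hδ _ s hs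
  refine ⟨t, T, hT, hTle.trans ?_, hopt⟩
  have hK : M * (2 * G.encLength f' + 1) + 1 ≤ 2 * M ^ 2 := by nlinarith
  calc _ ≤ 2 * M ^ 2 * (357 * M ^ 5) := Nat.mul_le_mul_right _ hK
    _ = 714 * M ^ 7 := by ring

end CongestionGame

/-! ### Assembling the polynomial bounds -/

namespace CongestionGame

variable {G : CongestionGame} {f' : Fin G.m → ℕ → ℚ}

/-- M = ⌈10X⁴⌉ ≤ 11X⁴ dominates L, the size of δ and 1/δ at once; the exponent is 28 = 4 · 7. -/
theorem exists_localSearch_of_le (h : ∀ e, ∀ n ≤ G.N, 0 ≤ f' e n) {δ X : ℚ} (hδ0 : 0 < δ)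
    (hL : (G.encLength f' : ℚ) + 2 ≤ X) (hδ : (ratSize δ : ℚ) ≤ 10 * X) (hδX : 1 / δ ≤ X ^ 4)
    (s : G.State) :
    ∃ (t : G.State) (T : ℕ), G.LocalSearch f' δ s t T ∧
      (T : ℚ) ≤ (714 * 11 ^ 7 : ℕ) * X ^ 28 ∧ G.IsApproxLocalOpt (G.zeta f') (1 + δ) t := by
  have hX : 2 ≤ X := le_trans (by linarith [Nat.cast_nonneg (α := ℚ) (G.encLength f')]) hL
  have hX4 : X ≤ X ^ 4 := le_self_pow₀ (by linarith) (by norm_num)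
  have hceil : 10 * X ^ 4 ≤ (⌈10 * X ^ 4⌉₊ : ℚ) := Nat.le_ceil _
  have hM : (⌈10 * X ^ 4⌉₊ : ℚ) ≤ 11 * X ^ 4 := by
    have := (Nat.ceil_lt_add_one (show 0 ≤ 10 * X ^ 4 by positivity)).le
    linarith
  obtain ⟨t, T, hT, hTle, hopt⟩ := exists_localSearch h (M := ⌈10 * X ^ 4⌉₊)
    (by rw [← Nat.cast_lt (α := ℚ)]; linarith) hδ0
    (by rw [← Nat.cast_le (α := ℚ)]; linarith) (by linarith) s
  refine ⟨t, T, hT, ?_, hopt⟩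
  calc (T : ℚ) ≤ 714 * (⌈10 * X ^ 4⌉₊ : ℚ) ^ 7 := by exact_mod_cast hTle
    _ ≤ 714 * (11 * X ^ 4) ^ 7 := by gcongr
    _ = _ := by push_cast; ring

end CongestionGame

theorem ratSize_natCast_add_one_le (n : ℕ) : ratSize ((n : ℚ) + 1) ≤ n + 2 := by
  have := ratSize_natCast_le (n + 1)
  rwa [Nat.cast_succ] at this

theorem ratSize_div_le (a b : ℚ) : ratSize (a / b) ≤ ratSize a + ratSize b := by
  rw [div_eq_mul_inv, ← ratSize_inv b]
  exact ratSize_mul_le a b⁻¹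

theorem mainTheorem4 :
    ∃ C d : ℕ, ∀ (G : CongestionGame) (f' : Fin G.m → ℕ → ℚ) (lam : Fin G.m → ℚ),
      (∀ e, LPscFeasible G.N (G.f e) (f' e) (lam e)) →
      ∀ ε : ℚ, 0 < ε → ∀ s₀ : G.State,
        (∃ (s : G.State) (T : ℕ),
          G.LocalSearch f' (ε / (G.N + 1)) s₀ s T ∧
          (T : ℚ) ≤ C * ((G.encLength f' : ℚ) + ratSize ε + 1 / ε) ^ d ∧
          G.IsApproxLocalOpt (G.zeta f') (1 + ε / (G.N + 1)) s ∧
          G.IsApproxLocalOpt G.socialCost (maxLam lam * (1 + ε)) s) ∧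
        (∃ (s : G.State) (T : ℕ),
          G.LocalSearch f' (ε / ((1 + ε) * (G.N + 1) ^ 2 * (⌈maxLam lam⌉₊ + 1))) s₀ s T ∧
          (T : ℚ) ≤ C * ((G.encLength f' : ℚ) + ratSize ε + maxLam lam + 1 / ε) ^ d ∧
          ∀ t : G.State, G.socialCost s ≤ maxLam lam * (1 + ε) * G.socialCost t) := by
  refine ⟨714 * 11 ^ 7, 28, fun G f' lam hlp ε hε s₀ => ?_⟩
  have h : ∀ e, LPscFeasible G.N (G.f e) (f' e) (maxLam lam) := fun e =>
    (hlp e).weaken (G.f_nonneg e) (le_maxLam lam e)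
  have hlam := maxLam_nonneg lam
  have hnn : ∀ e, ∀ n ≤ G.N, 0 ≤ f' e n := fun e => (h e).nonneg
  -- This absorbs the additive constants in the comparisons with `X` below.
  have hr : (2 : ℚ) ≤ ratSize ε := by exact_mod_cast two_le_ratSize hε
  have hinv : 0 < 1 / ε := by positivity
  have hN : (G.N : ℚ) ≤ G.encLength f' := by
    exact_mod_cast (Nat.le_add_right _ _).trans (G.N_add_m_le f')
  have hN0 : (0 : ℚ) ≤ G.N := Nat.cast_nonneg _
  have hsN := ratSize_natCast_add_one_le G.N
  constructor
  · set X : ℚ := (G.encLength f' : ℚ) + ratSize ε + 1 / ε with hX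
    have hδ : (ratSize (ε / (G.N + 1)) : ℚ) ≤ ratSize ε + (G.N + 2) := by
      exact_mod_cast (ratSize_div_le _ _).trans (Nat.add_le_add_left hsN _)
    have hδX : 1 / (ε / (G.N + 1)) ≤ X ^ 4 := by
      calc 1 / (ε / (G.N + 1)) = (G.N + 1) * (1 / ε) := by field_simp
        _ ≤ X * X := by gcongr <;> linarith
        _ = X ^ 2 := by ring
        _ ≤ X ^ 4 := pow_le_pow_right₀ (by linarith) (by norm_num)
    obtain ⟨s, T, hT, hTle, hopt⟩ := CongestionGame.exists_localSearch_of_le hnn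
      (X := X) (by positivity) (by linarith) (by linarith) hδX s₀
    exact ⟨s, T, hT, hTle, hopt, CongestionGame.isApproxLocalOpt_socialCost h hlam hε hopt⟩
  · set X : ℚ := (G.encLength f' : ℚ) + ratSize ε + maxLam lam + 1 / ε with hX
    have hceil : (⌈maxLam lam⌉₊ : ℚ) ≤ maxLam lam + 1 := (Nat.ceil_lt_add_one hlam).le
    -- The encoding of λ is not part of the input length; rounding it up keeps the size of δ linear
    -- in the value of λ.
    have hsize : ratSize (ε / ((1 + ε) * (G.N + 1) ^ 2 * (⌈maxLam lam⌉₊ + 1))) ≤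
        3 * ratSize ε + 2 * G.N + ⌈maxLam lam⌉₊ + 7 := by
      have h1 := ratSize_div_le ε ((1 + ε) * (G.N + 1) ^ 2 * (⌈maxLam lam⌉₊ + 1))
      have h2 := ratSize_mul_le ((1 + ε) * ((G.N : ℚ) + 1) ^ 2) (⌈maxLam lam⌉₊ + 1)
      have h3 := ratSize_mul_le (1 + ε) (((G.N : ℚ) + 1) ^ 2)
      have h4 := ratSize_mul_le ((G.N : ℚ) + 1) (G.N + 1)
      have h5 := ratSize_one_add_le ε
      have h6 := ratSize_natCast_add_one_le ⌈maxLam lam⌉₊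
      rw [← sq] at h4
      omega
    have hδ : (ratSize (ε / ((1 + ε) * (G.N + 1) ^ 2 * (⌈maxLam lam⌉₊ + 1))) : ℚ) ≤
        3 * ratSize ε + 2 * G.N + ⌈maxLam lam⌉₊ + 7 := by
      exact_mod_cast hsize
    have hδX : 1 / (ε / ((1 + ε) * (G.N + 1) ^ 2 * (⌈maxLam lam⌉₊ + 1))) ≤ X ^ 4 := by
      calc 1 / (ε / ((1 + ε) * ((G.N : ℚ) + 1) ^ 2 * (⌈maxLam lam⌉₊ + 1)))
          = (1 / ε + 1) * (G.N + 1) ^ 2 * (⌈maxLam lam⌉₊ + 1) := by field_simp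
        -- Each of 1/ε + 1, N + 1 and ⌈λ⌉ + 1 is at most `X`.
        _ ≤ X * X ^ 2 * X := by gcongr <;> linarith
        _ = X ^ 4 := by ring
    obtain ⟨s, T, hT, hTle, hopt⟩ := CongestionGame.exists_localSearch_of_le hnn
      (X := X) (by positivity) (by linarith) (by linarith) hδX s₀
    exact ⟨s, T, hT, hTle, CongestionGame.socialCost_le_of_isApproxLocalOpt h hlam hε hopt⟩
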